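/- **Theorem 1.** Setting. A network has a finite vertex set $\mathcal V$ of $n$ agents and a directed graph $\mathbb G$; $\mathcal N_i$ is the set of $j\ne i$ with an arc from $j$ to $i$. Agent $i$ has a convex function $f_i:\mathbb R^d\to\mathbb R$. A set $\mathcal F\subset\mathcal V$ of at most $\beta$ agents is Byzantine; the agents in $\mathcal H=\mathcal V\setminus\mathcal F$ are normal. For each $i$ and $x\in\mathbb R^d$, $g_i(x)$ is a subgradient of $f_i$ at $x$. Let $\mathcal X^*=\arg\min_x\sum_{i\in\mathcal V}f_i(x)$. Algorithm. Let $\mathcal A_{i1},\dots,\mathcal A_{ia_i}$ be all subsets of $\mathcal N_i$ of cardinality $(d+1)\beta+1$, where $a_i=\binom{|\mathcal N_i|}{(d+1)\beta+1}$. At each time $t=0,1,2,\dots$ every normal agent sends its state $x_i(t)\in\mathbb R^d$ to the agents that have it as a neighbor, whereas a Byzantine agent may send arbitrary values, possibly different ones to different agents. Each normal agent $i$, for each $j\in\{1,\dots,a_i\}$, picks an arbitrary point $y_{ij}(t)$ in the intersection, over all $\mathcal S\subset\mathcal A_{ij}$ with $|\mathcal S|=d\beta+1$, of the convex hulls of the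 values that $i$ received at time $t$ from the agents in $\mathcal S$, and then sets $$v_i(t)=\frac{1}{1+a_i}\Big(x_i(t)+\sum_{j=1}^{a_i}y_{ij}(t)\Big),\qquad x_i(t+1)=v_i(t)-\alpha(t)\,g_i(v_i(t)).$$ Redundancy. Let $r,s\ge 0$ with $r+s\le n-1$. An $(r,s)$-reduced graph of $\mathbb G$ is obtained by choosing a set of $n-r$ vertices and then removing from each vertex of the induced subgraph $s$ arbitrary incoming arcs (all of them if there are fewer than $s$). A root is a vertex from which every other vertex can be reached along a directed path. $\mathbb G$ is $(r,s)$-resilient if each of its $(r,s)$-reduced graphs has a root, and $\kappa_{r,s}(\mathbb G)$ is then the smallest number of roots of an $(r,s)$-reduced graph. The network is $k$-redundant, $k\in\{0,\dots,n-1\}$, if $\arg\min_x\sum_{i\in\mathcal S_1}f_i(x)=\arg\min_x\sum_{i\in\mathcal S_2}f_i(x)$ for all $\mathcal S_1,\mathcal S_2\subset\mathcal V$ with $|\mathcal S_1|=|\mathcal S_2|=n-k$. Claim. Assume that $\mathcal X^*$ has nonempty interior; that there is $D>0$ with $\|g_i(x)\|\le D$ for all $i\in\mathcal V$ and $x\in\mathbb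 R^d$; and that the stepsizes $\alpha(t)$ are positive and nonincreasing with $\sum_t\alpha(t)=\infty$ and $\sum_t\alpha(t)^2<\infty$. Assume that $\mathbb G$ is $(\beta,d\beta)$-resilient, and write $\kappa=\kappa_{\beta,d\beta}(\mathbb G)$. Assume that the network is $(n-\kappa)$-redundant, that $\arg\min_x\sum_{i\in\mathcal S}f_i(x)\neq\emptyset$ for every $\mathcal S\subset\mathcal V$ with $|\mathcal S|=\kappa$, and that $n-\kappa\ge 1$ (which is automatic when $\beta\ge 1$). Then, for all initial states, whatever the Byzantine agents send and whatever admissible points $y_{ij}(t)$ are picked, there is one point $x^*\in\mathcal X^*$ such that $x_i(t)\to x^*$ as $t\to\infty$ for every normal agent $i$. -/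

import Mathlib

open Filter Topology

/-- The set of minimizers of `x ↦ ∑ i ∈ S, f i x` over the whole space. -/
def argminSum {V E : Type*} (f : V → E → ℝ) (S : Finset V) : Set E :=
  {x | ∀ y, ∑ i ∈ S, f i x ≤ ∑ i ∈ S, f i y}

/-- `g` is a subgradient of `h` at `x`. -/
def IsSubgradient {d : ℕ} (h : EuclideanSpace ℝ (Fin d) → ℝ)
    (x g : EuclideanSpace ℝ (Fin d)) : Prop :=
  ∀ y, h x + inner ℝ g (y - x) ≤ h y

/-- A network of agents `V` with objectives `f` is `k`-redundant, `k ∈ {0, …, |V| - 1}`, if any two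
sets of `|V| - k` agents have the same set of aggregate minimizers. -/
def Redundant {V E : Type*} [Fintype V] (f : V → E → ℝ) (k : ℕ) : Prop :=
  k < Fintype.card V ∧ ∀ S₁ S₂ : Finset V,
    S₁.card = Fintype.card V - k → S₂.card = Fintype.card V - k →
      argminSum f S₁ = argminSum f S₂

open scoped Classical in
/-- The in-neighbors of `i`, excluding `i` itself; `G.Adj j i` is the arc from `j` to `i`. -/
noncomputable def inNeighbors {V : Type*} [Fintype V] (G : Digraph V) (i : V) : Finset V :=
  Finset.univ.filter fun j => j ≠ i ∧ G.Adj j i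

/-- A directed graph on a finite subset `verts` of an ambient type `V`. -/
structure VertexDigraph (V : Type*) where
  verts : Finset V
  Adj : V → V → Prop
  mem_of_adj : ∀ {i j}, Adj i j → i ∈ verts ∧ j ∈ verts

namespace VertexDigraph

variable {V : Type*}

/-- `i` is a root: every vertex of the graph is reachable from `i` along a directed path. -/
def IsRoot (K : VertexDigraph V) (i : V) : Prop :=
  i ∈ K.verts ∧ ∀ j ∈ K.verts, Relation.ReflTransGen K.Adj i j

/-- A graph is rooted if it has a root. -/
def Rooted (K : VertexDigraph V) : Prop := ∃ i, K.IsRoot i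

/-- The number of roots of the graph. -/
noncomputable def numRoots (K : VertexDigraph V) : ℕ := {i | K.IsRoot i}.ncard

end VertexDigraph

open scoped Classical in
/-- `K` is an `(r,s)`-reduced graph of `G`: choose a set of `|V| - r` vertices and then remove from
each vertex `i` of the induced subgraph `s` of its incoming arcs (those coming from the set
`removed i`), or all of them if there are fewer than `s`. -/
def IsReducedGraph {V : Type*} [Fintype V] (G : Digraph V) (r s : ℕ)
    (K : VertexDigraph V) : Prop :=
  K.verts.card + r = Fintype.card V ∧
  ∃ removed : V → Finset V,
    (∀ i ∈ K.verts, removed i ⊆ inNeighbors G i ∩ K.verts ∧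
      (removed i).card = min s (inNeighbors G i ∩ K.verts).card) ∧
    ∀ j i, K.Adj j i ↔ i ∈ K.verts ∧ j ∈ (inNeighbors G i ∩ K.verts) \ removed i

/-- `G` is `(r,s)`-resilient, where `r + s ≤ |V| - 1`: all `(r,s)`-reduced graphs are rooted. -/
def Resilient {V : Type*} [Fintype V] (G : Digraph V) (r s : ℕ) : Prop :=
  r + s + 1 ≤ Fintype.card V ∧ ∀ K : VertexDigraph V, IsReducedGraph G r s K → K.Rooted

/-- The smallest number of roots of an `(r,s)`-reduced graph of `G`. -/
noncomputable def kappa {V : Type*} [Fintype V] (G : Digraph V) (r s : ℕ) : ℕ :=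
  sInf {m | ∃ K : VertexDigraph V, IsReducedGraph G r s K ∧ K.numRoots = m}

/-- The sets of `(d+1)β + 1` neighbors of agent `i`. Their number is
`Nat.choose |N_i| ((d+1)β + 1)`. -/
noncomputable def neighborChoices {V : Type*} [Fintype V] (G : Digraph V) (d β : ℕ) (i : V) :
    Finset (Finset V) :=
  (inNeighbors G i).powersetCard ((d + 1) * β + 1)

/-- A run of the resilient distributed subgradient algorithm in which the agents of `byz` are
Byzantine. Here `x t i` is the state of agent `i` at time `t`, `msg t j i` is the value that `j`
sends to `i` at time `t`, `y t i A` is the point that `i` picks for the set `A` of neighbors, and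
`v t i` is the average that `i` forms. Normal agents send their true state and follow the update
rule. Nothing is required of the values sent by Byzantine agents, which may differ between
receivers. -/
structure IsRun {V : Type*} [Fintype V] {d : ℕ} (G : Digraph V) (β : ℕ) (byz : Finset V)
    (g : V → EuclideanSpace ℝ (Fin d) → EuclideanSpace ℝ (Fin d)) (α : ℕ → ℝ)
    (x : ℕ → V → EuclideanSpace ℝ (Fin d))
    (msg : ℕ → V → V → EuclideanSpace ℝ (Fin d))
    (y : ℕ → V → Finset V → EuclideanSpace ℝ (Fin d))
    (v : ℕ → V → EuclideanSpace ℝ (Fin d)) : Prop where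
  send : ∀ t, ∀ j ∉ byz, ∀ i, msg t j i = x t j
  pick : ∀ t, ∀ i ∉ byz, ∀ A ∈ neighborChoices G d β i, ∀ S ∈ A.powersetCard (d * β + 1),
    y t i A ∈ convexHull ℝ ((fun j => msg t j i) '' (S : Set V))
  average : ∀ t, ∀ i ∉ byz,
    v t i = (1 / (1 + ((neighborChoices G d β i).card : ℝ))) •
      (x t i + ∑ A ∈ neighborChoices G d β i, y t i A)
  step : ∀ t, ∀ i ∉ byz, x (t + 1) i = v t i - α t • g i (v t i)

/-! The picks hide the adversary. A set of `(d+1)β+1` neighbors contains at least `dβ+1` normal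
ones, and the picked point lies in the hull of every `dβ+1` of these. Averaging one convex
representation per such family shows that `v t i` is a convex combination of normal states in which
at most `dβ` normal in-neighbors of `i` get weight below a constant independent of time. The arcs of
substantial weight therefore contain a reduced graph and have at least `κ` roots
(`IsRun.exists_isMixing`). This needs exactly `β` agents to be discarded; the final theorem pads the
Byzantine set accordingly.

Among finitely many graphs, one recurs often in any window of a fixed length, so whatever its roots
hold reaches everyone with a definite factor (`IsMixing.exists_propagation`). This gives consensus,
as the steps vanish. It also means that a decrement at the roots lowers the values everywhere.

Redundancy makes the optimal set minimize every single objective: exchanging one agent shows each `f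
i` constant on it, and an interior point is then a local, hence global, minimizer
(`le_of_mem_of_forall_argminSum_eq`). So squared distances to any optimal point are averaged,
reduced by `α t` times an optimality gap, and raised by a summable error. As the stepsizes are not
summable, the total gap of some `κ` agents is small at arbitrarily late times
(`IsMixing.exists_sum_lt`). A cluster point along such times minimizes the aggregate of `κ` agents,
so it is optimal; distances to it can later grow only by a tail of the error series, which forces
convergence. -/

/-! ### Mixing weights and propagation from roots -/

/-- The arcs of weight at least `η` between vertices of `H`; `w i j` is the weight that `i` gives to
`j`. -/
def heavyGraph {V : Type*} (H : Finset V) (η : ℝ) (w : V → V → ℝ) : VertexDigraph V where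
  verts := H
  Adj j i := i ∈ H ∧ j ∈ H ∧ η ≤ w i j
  mem_of_adj h := ⟨h.2.1, h.1⟩

/-- A sequence of row-stochastic weights on `H` with self-weights at least `η`, all of whose heavy
graphs have at least `κ` roots. -/
structure IsMixing {V : Type*} (H : Finset V) (η : ℝ) (κ : ℕ) (w : ℕ → V → V → ℝ) : Prop where
  pos : 0 < η
  nonneg : ∀ t, ∀ i ∈ H, ∀ j ∈ H, 0 ≤ w t i j
  sum_one : ∀ t, ∀ i ∈ H, ∑ j ∈ H, w t i j = 1
  self : ∀ t, ∀ i ∈ H, η ≤ w t i i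
  roots : ∀ t, κ ≤ (heavyGraph H η (w t)).numRoots

namespace IsMixing

variable {V : Type*} {H : Finset V} {η : ℝ} {κ : ℕ} {w : ℕ → V → V → ℝ}

theorem le_one (hw : IsMixing H η κ w) (hH : H.Nonempty) : η ≤ 1 := by
  obtain ⟨i, hi⟩ := hH
  rw [← hw.sum_one 0 i hi]
  exact (hw.self 0 i hi).trans
    (Finset.single_le_sum (f := fun j => w 0 i j) (fun j hj => hw.nonneg 0 i hi j hj) hi)

theorem nonneg_of_superaveraging (hw : IsMixing H η κ w) {u : ℕ → V → ℝ} {t : ℕ}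
    (hu : ∀ s ≥ t, ∀ i ∈ H, ∑ j ∈ H, w s i j * u s j ≤ u (s + 1) i)
    (h0 : ∀ i ∈ H, 0 ≤ u t i) {s : ℕ} (hs : t ≤ s) : ∀ i ∈ H, 0 ≤ u s i := by
  induction s, hs using Nat.le_induction with
  | base => exact h0
  | succ s hs ih =>
    intro i hi
    exact (Finset.sum_nonneg fun j hj => mul_nonneg (hw.nonneg s i hi j hj) (ih j hj)).trans
      (hu s hs i hi)

open scoped Classical in
/-- In every window of a fixed length, the values at `κ` vertices propagate to all vertices. -/
theorem exists_propagation [Fintype V] (hw : IsMixing H η κ w) :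
    ∃ L : ℕ, ∀ t, ∃ R : Finset V, R ⊆ H ∧ κ ≤ R.card ∧ ∀ u : ℕ → V → ℝ,
      (∀ s ≥ t, ∀ i ∈ H, ∑ j ∈ H, w s i j * u s j ≤ u (s + 1) i) →
      (∀ i ∈ H, 0 ≤ u t i) → ∀ r ∈ R, ∀ i ∈ H, η ^ L * u t r ≤ u (t + L) i := by
  -- Pigeonhole: `N` counts all relations on `V`, so in a window of `N * |V|` steps some relation
  -- `A` occurs at least `|V|` times. The set `R` of its roots is fixed before `u`, so that one root
  -- can serve several choices of `u`.
  set N := Fintype.card (V → V → Prop) with hN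
  refine ⟨N * Fintype.card V, fun t => ?_⟩
  obtain ⟨A, -, hA⟩ := Finset.exists_le_card_fiber_of_mul_le_card_of_maps_to
    (s := Finset.range (N * Fintype.card V)) (t := (Finset.univ : Finset (V → V → Prop)))
    (f := fun k => (heavyGraph H η (w (t + k))).Adj) (n := Fintype.card V)
    (fun _ _ => Finset.mem_univ _) Finset.univ_nonempty (by simp [hN])
  set R : Finset V := H.filter fun r => ∀ j ∈ H, Relation.ReflTransGen A r j with hR
  by_cases hV : IsEmpty V
  · refine ⟨∅, by simp, ?_, by simp⟩
    refine (hw.roots 0).trans ?_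
    rw [VertexDigraph.numRoots, Set.eq_empty_of_isEmpty {i | _}]
    simp
  rw [not_isEmpty_iff] at hV
  have hAk : ∃ k, (heavyGraph H η (w (t + k))).Adj = A := by
    have : 0 < Fintype.card V := Fintype.card_pos
    obtain ⟨k, hk⟩ := Finset.card_pos.1 (this.trans_le hA)
    exact ⟨k, (Finset.mem_filter.1 hk).2⟩
  refine ⟨R, Finset.filter_subset _ _, ?_, fun u hu h0 r hr => ?_⟩
  · obtain ⟨k, hk⟩ := hAk
    refine (hw.roots (t + k)).trans (le_of_eq ?_)
    rw [VertexDigraph.numRoots, ← Set.ncard_coe_finset]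
    congr 1
    ext r
    rw [Set.mem_ofPred_eq, VertexDigraph.IsRoot, hk, hR, Finset.coe_filter]
    rfl
  · have hrH : r ∈ H := (Finset.mem_filter.1 hr).1
    have hrR := (Finset.mem_filter.1 hr).2
    have hpow : ∀ k, 0 ≤ η ^ k * u t r := fun k => mul_nonneg (pow_nonneg hw.pos.le k) (h0 r hrH)
    have step : ∀ k, ∀ i ∈ H, ∀ j ∈ H, η ≤ w (t + k) i j → η ^ k * u t r ≤ u (t + k) j →
        η ^ (k + 1) * u t r ≤ u (t + k + 1) i := by
      intro k i hi j hj hij hjr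
      have hnn := hw.nonneg_of_superaveraging hu h0 (Nat.le_add_right t k)
      calc η ^ (k + 1) * u t r = η * (η ^ k * u t r) := by ring
        _ ≤ w (t + k) i j * u (t + k) j := mul_le_mul hij hjr (hpow k) (hw.nonneg _ i hi j hj)
        _ ≤ ∑ j ∈ H, w (t + k) i j * u (t + k) j :=
          Finset.single_le_sum (f := fun j => w (t + k) i j * u (t + k) j)
            (fun j hj => mul_nonneg (hw.nonneg _ i hi j hj) (hnn j hj)) hj
        _ ≤ _ := hu _ (Nat.le_add_right t k) i hi
    -- The set of vertices already reached never shrinks, by the self-weights, and gains a vertex at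
    -- each occurrence of `A` until it is all of `H`. It starts with `r`, hence the `+ 1`, which
    -- rules out the second alternative after `|V|` occurrences.
    have key : ∀ k, (∀ i ∈ H, η ^ k * u t r ≤ u (t + k) i) ∨
        ((Finset.range k).filter fun l => (heavyGraph H η (w (t + l))).Adj = A).card + 1 ≤
          (H.filter fun i => η ^ k * u t r ≤ u (t + k) i).card := by
      intro k
      induction k with
      | zero =>
        right
        simp only [Finset.range_zero, Finset.filter_empty, Finset.card_empty, zero_add]
        exact Finset.card_pos.2 ⟨r, by simp [hrH]⟩
      | succ k ih =>
        have hself : ∀ i ∈ H, η ^ k * u t r ≤ u (t + k) i →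
            η ^ (k + 1) * u t r ≤ u (t + (k + 1)) i := fun i hi h =>
          step k i hi i hi (hw.self _ i hi) h
        have hsub : (H.filter fun i => η ^ k * u t r ≤ u (t + k) i) ⊆
            H.filter fun i => η ^ (k + 1) * u t r ≤ u (t + (k + 1)) i := by
          intro i hi
          rw [Finset.mem_filter] at hi ⊢
          exact ⟨hi.1, hself i hi.1 hi.2⟩
        rcases ih with ih | ih
        · exact Or.inl fun i hi => hself i hi (ih i hi)
        rw [or_iff_not_imp_left]
        intro hnot
        rw [Finset.range_add_one, Finset.filter_insert]
        split_ifs with hk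
        · rw [Finset.card_insert_of_notMem (by simp)]
          refine Nat.succ_le_of_lt (lt_of_le_of_lt ih (Finset.card_lt_card ?_))
          -- Without growth the reached set is closed under the arcs of `A`; as it contains the root
          -- `r`, it is all of `H`.
          refine ⟨hsub, fun hsup => hnot fun i hi => ?_⟩
          have hri : Relation.ReflTransGen A r i := hrR i hi
          have hall : i ∈ H ∧ η ^ k * u t r ≤ u (t + k) i := by
            induction hri with
            | refl =>
              refine ⟨hrH, ?_⟩
              have : ∀ m, η ^ m * u t r ≤ u (t + m) r := by
                intro m
                induction m with
                | zero => simp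
                | succ m ihm => exact step m r hrH r hrH (hw.self _ r hrH) ihm
              exact this k
            | tail _ hbc ihb =>
              rw [← hk] at hbc
              have hb := ihb hbc.2.1
              have := hsup (Finset.mem_filter.2 ⟨hbc.1, step k _ hbc.1 _ hb.1 hbc.2.2 hb.2⟩)
              exact Finset.mem_filter.1 this
          exact hself i hi hall.2
        · exact ih.trans (Finset.card_le_card hsub)
    rcases key (N * Fintype.card V) with h | h
    · exact h
    · have h1 : (H.filter fun i => η ^ (N * Fintype.card V) * u t r ≤
          u (t + N * Fintype.card V) i).card ≤ Fintype.card V := Finset.card_le_univ _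
      simp only [Fintype.card] at *
      omega

end IsMixing

/-! ### In-degrees of resilient graphs -/

open scoped Classical in
/-- A vertex of small in-degree can be isolated in some reduced graph, so that a resilient graph has
large in-degrees. -/
theorem Resilient.card_lt_card_inNeighbors {V : Type*} [Fintype V] {G : Digraph V} {r s : ℕ}
    (hG : Resilient G r s) (hs : 1 ≤ s) (i : V) : r + s < (inNeighbors G i).card := by
  by_contra! hi
  have hself : ∀ j, j ∉ inNeighbors G j := fun j => by simp [inNeighbors]
  -- Deleting in-neighbors of `i` first leaves at most `s` arcs into `i`, all of which can then be
  -- cut.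
  have hX : ∃ X : Finset V, i ∉ X ∧ X.card = r ∧ (inNeighbors G i \ X).card ≤ s := by
    rcases le_total r (inNeighbors G i).card with h | h
    · obtain ⟨X, hX, hXc⟩ := Finset.exists_subset_card_eq h
      refine ⟨X, fun h => hself i (hX h), hXc, ?_⟩
      rw [Finset.card_sdiff_of_subset hX]
      omega
    · obtain ⟨X, hX, hX', hXc⟩ := Finset.exists_subsuperset_card_eq
        (s := inNeighbors G i) (t := Finset.univ.erase i) (n := r)
        (fun j hj => Finset.mem_erase.2 ⟨fun h => hself i (h ▸ hj), Finset.mem_univ j⟩) h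
        (by rw [Finset.card_erase_of_mem (Finset.mem_univ i), Finset.card_univ]
            have := hG.1
            omega)
      refine ⟨X, fun h => by simpa using hX' h, hXc, ?_⟩
      rw [Finset.sdiff_eq_empty_iff_subset.2 hX]
      simp
  obtain ⟨X, hiX, hXc, hXs⟩ := hX
  -- Since `s ≥ 1`, the cut at each `j` can include the arc from `i`, so `i` also loses its outgoing
  -- arcs.
  have hcut : ∀ j, ∃ D ⊆ inNeighbors G j ∩ Xᶜ, D.card = min s (inNeighbors G j ∩ Xᶜ).card ∧
      (i ∈ inNeighbors G j ∩ Xᶜ → i ∈ D) := by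
    intro j
    by_cases h : i ∈ inNeighbors G j ∩ Xᶜ
    · obtain ⟨D, h1, h2, h3⟩ := Finset.exists_subsuperset_card_eq
        (s := {i}) (t := inNeighbors G j ∩ Xᶜ) (n := min s (inNeighbors G j ∩ Xᶜ).card)
        (by simpa using h)
        (by
          have := Finset.card_pos.2 ⟨i, h⟩
          simp only [Finset.card_singleton]
          omega) (min_le_right _ _)
      exact ⟨D, h2, h3, fun _ => h1 (Finset.mem_singleton_self i)⟩
    · obtain ⟨D, h1, h2⟩ := Finset.exists_subset_card_eq
        (min_le_right s (inNeighbors G j ∩ Xᶜ).card)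
      exact ⟨D, h1, h2, fun h' => absurd h' h⟩
  choose D hD hDc hDi using hcut
  let K : VertexDigraph V :=
    { verts := Xᶜ
      Adj := fun j k => k ∈ Xᶜ ∧ j ∈ (inNeighbors G k ∩ Xᶜ) \ D k
      mem_of_adj := fun h =>
        ⟨(Finset.mem_inter.1 (Finset.mem_sdiff.1 h.2).1).2, h.1⟩ }
  have hin : ∀ j, ¬ K.Adj j i := by
    rintro j ⟨-, hj⟩
    have : D i = inNeighbors G i ∩ Xᶜ := by
      refine Finset.eq_of_subset_of_card_le (hD i) ?_
      rw [hDc i]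
      refine le_min ?_ le_rfl
      rwa [← Finset.sdiff_eq_inter_compl]
    simp [this] at hj
  have hout : ∀ j, ¬ K.Adj i j := by
    rintro j ⟨-, hj⟩
    rw [Finset.mem_sdiff] at hj
    exact hj.2 (hDi j hj.1)
  have hcard : Xᶜ.card + r = Fintype.card V := by
    rw [Finset.card_compl, hXc]
    have := hG.1
    omega
  obtain ⟨q, hq, hroot⟩ := hG.2 K ⟨hcard, D, fun k _ => ⟨hD k, hDc k⟩, fun j k => Iff.rfl⟩
  have hiK : i ∈ K.verts := Finset.mem_compl.2 hiX
  have hqi : i = q := by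
    rcases (hroot i hiK).cases_tail with h | ⟨c, -, hc⟩
    · exact h
    · exact absurd hc (hin c)
  -- At least `s + 1 ≥ 2` vertices remain, so an isolated vertex excludes any root.
  obtain ⟨k, hk, hki⟩ := Finset.exists_mem_ne (s := Xᶜ) (by have := hG.1; omega) i
  rcases (hroot k hk).cases_head with h | ⟨c, hc, -⟩
  · exact hki (h ▸ hqi.symm)
  · exact hout c (hqi ▸ hc)

/-! ### Convex representations and heavy arcs -/

/-- `w` are the weights of a convex combination of the points `p j`, `j ∈ H`, with value `q`. -/
structure IsAveraging {V E : Type*} [AddCommGroup E] [Module ℝ E] (H : Finset V) (p : V → E)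
    (q : E) (w : V → ℝ) : Prop where
  nonneg : ∀ j ∈ H, 0 ≤ w j
  sum_one : ∑ j ∈ H, w j = 1
  sum_smul : ∑ j ∈ H, w j • p j = q

namespace IsAveraging

variable {V E : Type*} [AddCommGroup E] [Module ℝ E] {H : Finset V} {p : V → E}

theorem sum {ι : Type*} {s : Finset ι} {c : ι → ℝ} (hc : ∀ k ∈ s, 0 ≤ c k)
    (hc1 : ∑ k ∈ s, c k = 1) {q : ι → E} {w : ι → V → ℝ}
    (hw : ∀ k ∈ s, IsAveraging H p (q k) (w k)) :
    IsAveraging H p (∑ k ∈ s, c k • q k) (fun j => ∑ k ∈ s, c k * w k j) where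
  nonneg j hj := Finset.sum_nonneg fun k hk => mul_nonneg (hc k hk) ((hw k hk).nonneg j hj)
  sum_one := by
    rw [Finset.sum_comm, ← hc1]
    refine Finset.sum_congr rfl fun k hk => ?_
    rw [← Finset.mul_sum, (hw k hk).sum_one, mul_one]
  sum_smul := by
    simp_rw [Finset.sum_smul]
    rw [Finset.sum_comm]
    refine Finset.sum_congr rfl fun k hk => ?_
    rw [← (hw k hk).sum_smul, Finset.smul_sum]
    simp_rw [mul_smul]

theorem single [DecidableEq V] {i : V} (hi : i ∈ H) : IsAveraging H p (p i) (fun j => if j = i then 1 else 0) where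
  nonneg j _ := by split_ifs <;> norm_num
  sum_one := by simp [hi]
  sum_smul := by simp [hi]

open scoped Classical in
theorem mono {S : Finset V} (hS : S ⊆ H) {q : E} {w : V → ℝ} (hw : IsAveraging S p q w) :
    IsAveraging H p q (fun j => if j ∈ S then w j else 0) where
  nonneg j _ := by
    split_ifs with h
    exacts [hw.nonneg j h, le_rfl]
  sum_one := by
    rw [← hw.sum_one, Finset.sum_ite_mem, Finset.inter_eq_right.2 hS]
  sum_smul := by
    simp_rw [ite_smul, zero_smul]
    rw [← hw.sum_smul, Finset.sum_ite_mem, Finset.inter_eq_right.2 hS]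

theorem exists_of_mem_convexHull {q : E} (hq : q ∈ convexHull ℝ (p '' (H : Set V))) :
    ∃ w, IsAveraging H p q w := by
  classical
  refine convexHull_min (s := p '' (H : Set V)) (t := {q | ∃ w, IsAveraging H p q w}) ?_ ?_ hq
  · rintro _ ⟨i, hi, rfl⟩
    exact ⟨_, single hi⟩
  · rintro q₁ ⟨w₁, h₁⟩ q₂ ⟨w₂, h₂⟩ a b ha hb hab
    refine ⟨fun j => a * w₁ j + b * w₂ j, fun j hj => ?_, ?_, ?_⟩
    · have := h₁.nonneg j hj
      have := h₂.nonneg j hj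
      positivity
    · rw [Finset.sum_add_distrib, ← Finset.mul_sum, ← Finset.mul_sum, h₁.sum_one, h₂.sum_one]
      linarith
    · simp_rw [add_smul, mul_smul]
      rw [Finset.sum_add_distrib, ← Finset.smul_sum, ← Finset.smul_sum, h₁.sum_smul, h₂.sum_smul]

/-- A point in the convex hulls of all families in `T` is an average that gives a substantial weight
to a member of each family. -/
theorem exists_of_mem_convexHulls {m : ℕ} (hm : 0 < m) {q : E} {T : Finset (Finset V)}
    (hT : T.Nonempty) (hTm : ∀ S ∈ T, S ⊆ H ∧ S.card = m)
    (hq : ∀ S ∈ T, q ∈ convexHull ℝ (p '' (S : Set V))) :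
    ∃ w, IsAveraging H p q w ∧ ∀ S ∈ T, ∃ j ∈ S, 1 / (T.card * m : ℝ) ≤ w j := by
  classical
  choose! w hw using fun S hS => exists_of_mem_convexHull (hq S hS)
  have hTpos : (0 : ℝ) < T.card := by exact_mod_cast hT.card_pos
  have hmono := fun S hS => (hw S hS).mono (hTm S hS).1
  -- The uniform average of one representation per family: some member of `S` has weight at least `1
  -- / m` in the representation over `S`, and the average costs a factor `|T|`.
  refine ⟨fun j => ∑ S ∈ T, (1 / (T.card : ℝ)) * if j ∈ S then w S j else 0, ?_, ?_⟩
  · have := IsAveraging.sum (s := T) (c := fun _ => 1 / (T.card : ℝ)) (q := fun _ => q)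
      (fun _ _ => by positivity) (by simp [hTpos.ne']) hmono
    convert this using 1
    rw [← Finset.sum_smul]
    simp [hTpos.ne']
  · intro S hS
    obtain ⟨j, hj, hjw⟩ : ∃ j ∈ S, 1 / (m : ℝ) ≤ w S j := by
      refine Finset.exists_le_of_sum_le (Finset.card_pos.1 ((hTm S hS).2 ▸ hm)) ?_
      rw [(hw S hS).sum_one, Finset.sum_const, (hTm S hS).2, nsmul_eq_mul]
      exact (mul_one_div_cancel (by positivity : (m : ℝ) ≠ 0)).le
    refine ⟨j, hj, ?_⟩
    have h1 : (1 / (T.card : ℝ)) * w S j ≤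
        ∑ S ∈ T, (1 / (T.card : ℝ)) * if j ∈ S then w S j else 0 := by
      have := Finset.single_le_sum
        (f := fun S => (1 / (T.card : ℝ)) * if j ∈ S then w S j else 0) (fun S' hS' =>
          mul_nonneg (by positivity) ((hmono S' hS').nonneg j ((hTm S hS).1 hj))) hS
      simpa [hj] using this
    refine le_trans ?_ h1
    rw [one_div_mul_eq_div, ← div_div, div_right_comm]
    exact div_le_div_of_nonneg_right hjw hTpos.le

end IsAveraging

open scoped Classical in
/-- If only few normal in-neighbors of each vertex are light, then the heavy graph contains a reduced
graph, and so it has at least `kappa` roots. -/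
theorem kappa_le_numRoots_heavyGraph {V : Type*} [Fintype V] {G : Digraph V} {r s : ℕ}
    {H : Finset V} (hH : H.card + r = Fintype.card V) {η : ℝ} {w : V → V → ℝ}
    (hw : ∀ i ∈ H, ((inNeighbors G i ∩ H).filter fun j => w i j < η).card ≤ s) :
    kappa G r s ≤ (heavyGraph H η w).numRoots := by
  have hcut : ∀ i, ∃ D : Finset V, i ∈ H → D ⊆ inNeighbors G i ∩ H ∧
      D.card = min s (inNeighbors G i ∩ H).card ∧
      ((inNeighbors G i ∩ H).filter fun j => w i j < η) ⊆ D := by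
    intro i
    -- The cut is enlarged from the light neighbors to the exact size that a reduced graph demands;
    -- the surviving arcs are all heavy.
    by_cases hi : i ∈ H
    · obtain ⟨D, h1, h2, h3⟩ := Finset.exists_subsuperset_card_eq
        (Finset.filter_subset (fun j => w i j < η) (inNeighbors G i ∩ H))
        (le_min (hw i hi) (Finset.card_filter_le _ _)) (min_le_right _ _)
      exact ⟨D, fun _ => ⟨h2, h3, h1⟩⟩
    · exact ⟨∅, fun h => absurd h hi⟩
  choose D hD using hcut
  let K : VertexDigraph V :=
    { verts := H
      Adj := fun j i => i ∈ H ∧ j ∈ (inNeighbors G i ∩ H) \ D i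
      mem_of_adj := fun h => ⟨(Finset.mem_inter.1 (Finset.mem_sdiff.1 h.2).1).2, h.1⟩ }
  have hK : IsReducedGraph G r s K :=
    ⟨hH, D, fun i hi => ⟨(hD i hi).1, (hD i hi).2.1⟩, fun j i => Iff.rfl⟩
  have hκ : kappa G r s ≤ K.numRoots := Nat.sInf_le (show K.numRoots ∈
    {m | ∃ K : VertexDigraph V, IsReducedGraph G r s K ∧ K.numRoots = m} from ⟨K, hK, rfl⟩)
  refine hκ.trans ?_
  refine Set.ncard_le_ncard (fun i (hi : K.IsRoot i) => ?_) (Set.toFinite _)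
  refine (⟨hi.1, fun j hj => Relation.ReflTransGen.mono (fun a b hab => ?_) _ _ (hi.2 j hj)⟩ :
    (heavyGraph H η w).IsRoot i)
  obtain ⟨hb, ha⟩ := hab
  rw [Finset.mem_sdiff] at ha
  refine ⟨hb, (Finset.mem_inter.1 ha.1).2, ?_⟩
  by_contra! hlt
  exact ha.2 ((hD b hb).2.2 (Finset.mem_filter.2 ⟨ha.1, hlt⟩))

/-! ### Runs as averaging over normal agents -/

section Run

variable {V : Type*} [Fintype V] {d : ℕ} {G : Digraph V} {β : ℕ} {byz : Finset V}
  {g : V → EuclideanSpace ℝ (Fin d) → EuclideanSpace ℝ (Fin d)} {α : ℕ → ℝ}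
  {x : ℕ → V → EuclideanSpace ℝ (Fin d)} {msg : ℕ → V → V → EuclideanSpace ℝ (Fin d)}
  {y : ℕ → V → Finset V → EuclideanSpace ℝ (Fin d)} {v : ℕ → V → EuclideanSpace ℝ (Fin d)}

/-- All the rules bind normal agents only, so a well-behaved agent may be declared Byzantine. -/
theorem IsRun.mono (h : IsRun G β byz g α x msg y v) {byz' : Finset V} (hb : byz ⊆ byz') :
    IsRun G β byz' g α x msg y v where
  send t j hj := h.send t j fun hj' => hj (hb hj')
  pick t i hi := h.pick t i fun hi' => hi (hb hi')
  average t i hi := h.average t i fun hi' => hi (hb hi')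
  step t i hi := h.step t i fun hi' => hi (hb hi')

/-- Only the families of normal agents inside `A` are used, where messages are true states. Their
number is bounded crudely by that of all subsets of `V`, to make the weight independent of `t`, `i`
and `A`. -/
theorem IsRun.exists_averaging_pick [DecidableEq V] (h : IsRun G β byz g α x msg y v)
    (hbyz : byz.card ≤ β)
    (t : ℕ) {i : V} (hi : i ∉ byz) {A : Finset V} (hA : A ∈ neighborChoices G d β i) :
    ∃ w, IsAveraging byzᶜ (x t) (y t i A) w ∧
      ∀ S ⊆ A ∩ byzᶜ, S.card = d * β + 1 →
        ∃ j ∈ S, 1 / (Fintype.card (Finset V) * (d * β + 1 : ℕ) : ℝ) ≤ w j := by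
  have hAc := (Finset.mem_powersetCard.1 hA).2
  have hcard : d * β + 1 ≤ (A ∩ byzᶜ).card := by
    have h1 := Finset.le_card_sdiff byz A
    rw [Finset.sdiff_eq_inter_compl, hAc, add_mul] at h1
    omega
  obtain ⟨w, hw, hwS⟩ := IsAveraging.exists_of_mem_convexHulls (H := byzᶜ) (p := x t)
    (q := y t i A) (T := (A ∩ byzᶜ).powersetCard (d * β + 1)) (Nat.succ_pos (d * β))
    (Finset.powersetCard_nonempty.2 hcard)
    (fun S hS => ⟨((Finset.mem_powersetCard.1 hS).1).trans Finset.inter_subset_right,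
      (Finset.mem_powersetCard.1 hS).2⟩)
    (fun S hS => by
      rw [Finset.mem_powersetCard] at hS
      have := h.pick t i hi A hA S
        (Finset.mem_powersetCard.2 ⟨hS.1.trans Finset.inter_subset_left, hS.2⟩)
      rwa [Set.image_congr (g := x t) fun j hj => h.send t j (by
        simpa using (Finset.mem_inter.1 (hS.1 hj)).2) i] at this)
  refine ⟨w, hw, fun S hS hSc => ?_⟩
  have hST := Finset.mem_powersetCard.2 ⟨hS, hSc⟩
  obtain ⟨j, hj, hjw⟩ := hwS S hST
  refine ⟨j, hj, le_trans ?_ hjw⟩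
  refine one_div_le_one_div_of_le ?_ ?_
  · have : 0 < ((A ∩ byzᶜ).powersetCard (d * β + 1)).card := Finset.card_pos.2 ⟨S, hST⟩
    positivity
  · gcongr
    exact Finset.card_le_univ _

/-- The least weight that a non-light neighbor receives. -/
noncomputable def minWeight (V : Type*) [Fintype V] (m : ℕ) : ℝ :=
  1 / (1 + Fintype.card (Finset V)) * (1 / (Fintype.card (Finset V) * m))

/-- If `dβ + 1` normal in-neighbors were light, they would extend to a set `A` of choices whose pick
gives one of them a substantial weight. The degree hypothesis provides room for `A`, or else there
are too few in-neighbors for a violation. -/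
theorem IsRun.exists_averaging [DecidableEq V] (h : IsRun G β byz g α x msg y v)
    (hbyz : byz.card ≤ β) (t : ℕ) {i : V} (hi : i ∉ byz)
    (hdeg : (d + 1) * β + 1 ≤ (inNeighbors G i).card ∨ (inNeighbors G i).card ≤ d * β) :
    ∃ w, IsAveraging byzᶜ (x t) (v t i) w ∧ minWeight V (d * β + 1) ≤ w i ∧
      ((inNeighbors G i ∩ byzᶜ).filter fun j => w j < minWeight V (d * β + 1)).card ≤ d * β := by
  choose! q hq hqS using fun A hA => h.exists_averaging_pick hbyz t hi (A := A) hA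
  set C := neighborChoices G d β i with hC
  set a : ℝ := 1 / (1 + C.card) with ha
  have ha0 : 0 < a := by positivity
  have hiH : i ∈ byzᶜ := by simpa using hi
  have hcard : (1 : ℝ) ≤ Fintype.card (Finset V) := by exact_mod_cast Fintype.card_pos
  have hκ : (1 : ℝ) ≤ (d * β + 1 : ℕ) := by exact_mod_cast Nat.succ_pos _
  have haC : 1 / (1 + (Fintype.card (Finset V) : ℝ)) ≤ a := by
    rw [ha]
    gcongr
    exact Finset.card_le_univ _
  have hsingle := IsAveraging.single (p := x t) hiH
  -- The index `none` stands for the agent's own state, and `some A` for the pick from `A`.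
  have havg := IsAveraging.sum (s := Finset.insertNone C) (c := fun _ => a)
    (q := fun o => o.elim (x t i) (y t i))
    (w := fun o => o.elim (fun j => if j = i then 1 else 0) q) (fun _ _ => ha0.le)
    (by
      rw [Finset.sum_const, Finset.card_insertNone, nsmul_eq_mul, ha]
      push_cast
      field_simp
      ring)
    (by
      rintro (_ | A) hA
      · exact hsingle
      · exact hq A (by simpa using hA))
  have hle : ∀ o ∈ Finset.insertNone C, ∀ j ∈ byzᶜ,
      a * (o.elim (fun j => if j = i then 1 else 0) q : V → ℝ) j ≤
      ∑ o ∈ Finset.insertNone C, a * (o.elim (fun j => if j = i then 1 else 0) q : V → ℝ) j := by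
    intro o ho j hj
    refine Finset.single_le_sum
      (f := fun o => a * (o.elim (fun j => if j = i then 1 else 0) q : V → ℝ) j) ?_ ho
    rintro (_ | A) hA
    · exact mul_nonneg ha0.le (hsingle.nonneg j hj)
    · exact mul_nonneg ha0.le ((hq A (by simpa using hA)).nonneg j hj)
  refine ⟨fun j => ∑ o ∈ Finset.insertNone C,
      a * (o.elim (fun j => if j = i then 1 else 0) q : V → ℝ) j, ?_, ?_, ?_⟩
  · convert havg using 1
    rw [h.average t i hi, Finset.sum_insertNone]
    simp [smul_add, Finset.smul_sum, ha, hC]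
  · refine le_trans ?_ (hle none (by simp) i hiH)
    simp only [Option.elim, if_true, mul_one]
    refine le_trans ?_ haC
    rw [minWeight]
    refine mul_le_of_le_one_right (by positivity) ?_
    rw [div_le_one (by positivity)]
    nlinarith
  · by_contra! hlt
    obtain ⟨S, hS, hSc⟩ := Finset.exists_subset_card_eq (Nat.succ_le_of_lt hlt)
    have hSN : S ⊆ inNeighbors G i ∩ byzᶜ := hS.trans (Finset.filter_subset _ _)
    have hSN' : S ⊆ inNeighbors G i := hSN.trans Finset.inter_subset_left
    have hdeg' : (d + 1) * β + 1 ≤ (inNeighbors G i).card := by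
      have := Finset.card_le_card hSN'
      omega
    obtain ⟨A, hSA, hA, hAc⟩ := Finset.exists_subsuperset_card_eq hSN' (n := (d + 1) * β + 1)
      (by rw [hSc, add_mul]; omega) hdeg'
    have hAC : A ∈ C := Finset.mem_powersetCard.2 ⟨hA, hAc⟩
    obtain ⟨j, hj, hjw⟩ := hqS A hAC S
      (Finset.subset_inter hSA (hSN.trans Finset.inter_subset_right)) hSc
    refine absurd (Finset.mem_filter.1 (hS hj)).2 (not_lt.2 ?_)
    refine le_trans ?_ (hle (some A) (by simpa using hAC) j (Finset.mem_inter.1 (hSN hj)).2)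
    rw [minWeight]
    exact mul_le_mul haC hjw (by positivity) ha0.le

theorem IsRun.exists_isMixing [DecidableEq V] (h : IsRun G β byz g α x msg y v)
    (hbyz : byz.card = β) (hd : 0 < d) (hG : Resilient G β (d * β)) :
    ∃ (η : ℝ) (w : ℕ → V → V → ℝ), IsMixing byzᶜ η (kappa G β (d * β)) w ∧
      ∀ t, ∀ i ∈ byzᶜ, IsAveraging byzᶜ (x t) (v t i) (w t i) := by
  have hdeg : ∀ i, (d + 1) * β + 1 ≤ (inNeighbors G i).card ∨
      (inNeighbors G i).card ≤ d * β := by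
    intro i
    rcases Nat.eq_zero_or_pos β with h0 | h0
    · simp only [h0, mul_zero]
      omega
    · left
      have := hG.card_lt_card_inNeighbors (Nat.mul_pos hd h0) i
      rw [add_mul]
      omega
  choose! w hw hself hlight using fun t i (hi : i ∉ byz) =>
    h.exists_averaging hbyz.le t hi (hdeg i)
  have hw' : ∀ t, ∀ i ∈ byzᶜ, IsAveraging byzᶜ (x t) (v t i) (w t i) := fun t i hi =>
    hw t i (by simpa using hi)
  have hcard : 0 < Fintype.card (Finset V) := Fintype.card_pos
  refine ⟨minWeight V (d * β + 1), w, ⟨?_, fun t i hi => (hw' t i hi).nonneg,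
    fun t i hi => (hw' t i hi).sum_one, fun t i hi => hself t i (by simpa using hi), fun t => ?_⟩,
    hw'⟩
  · rw [minWeight]
    positivity
  · refine kappa_le_numRoots_heavyGraph ?_ fun i hi => ?_
    · rw [← hbyz, Finset.card_compl_add_card]
    · convert hlight t i (by simpa using hi)

end Run

/-! ### Consensus -/

theorem tendsto_zero_of_le_mul_add {c e : ℕ → ℝ} {q : ℝ} (hq0 : 0 ≤ q) (hq : q < 1)
    (hc : ∀ k, 0 ≤ c k) (he : Tendsto e atTop (𝓝 0)) (h : ∀ k, c (k + 1) ≤ q * c k + e k) :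
    Tendsto c atTop (𝓝 0) := by
  rw [Metric.tendsto_atTop]
  intro ε hε
  have hq' : 0 < 1 - q := by linarith
  obtain ⟨K, hK⟩ := (he.eventually (gt_mem_nhds (show 0 < ε / 2 * (1 - q) by positivity))).exists_forall_of_atTop
  -- Once `e` is below `(1 - q) * ε / 2`, the excess of `c` over `ε / 2` contracts by the factor
  -- `q`.
  have hstep : ∀ k, c (K + k) - ε / 2 ≤ q ^ k * c K := by
    intro k
    induction k with
    | zero => simp; linarith
    | succ k ih =>
      have h1 := h (K + k)
      have h2 := hK (K + k) (Nat.le_add_right _ _)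
      have h3 := mul_le_mul_of_nonneg_left ih hq0
      rw [pow_succ, ← add_assoc]
      linarith
  have hlim : Tendsto (fun k => q ^ k * c K) atTop (𝓝 0) := by
    simpa using (tendsto_pow_atTop_nhds_zero_of_lt_one hq0 hq).mul_const (c K)
  obtain ⟨M, hM⟩ := (hlim.eventually (gt_mem_nhds (half_pos hε))).exists_forall_of_atTop
  refine ⟨K + M, fun n hn => ?_⟩
  obtain ⟨k, rfl⟩ := Nat.exists_eq_add_of_le ((Nat.le_add_right K M).trans hn)
  have h1 := hM k (by omega)
  have h2 := hstep k
  rw [Real.dist_eq, sub_zero, abs_of_nonneg (hc _)]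
  linarith

theorem tendsto_atTop_of_forall_residue {X : Type*} [TopologicalSpace X] {c : ℕ → X} {l : X}
    {P : ℕ} (hP : 0 < P) (h : ∀ r, Tendsto (fun k => c (r + k * P)) atTop (𝓝 l)) :
    Tendsto c atTop (𝓝 l) := by
  intro U hU
  have h' : ∀ r, ∃ K, ∀ k ≥ K, c (r + k * P) ∈ U := fun r => by
    simpa using (h r) hU
  choose K hK using h'
  have hb : ∀ r ∈ Finset.range P, K r ≤ (Finset.range P).sup K := fun r hr => Finset.le_sup hr
  refine mem_atTop_sets.2 ⟨(Finset.range P).sup K * P, fun n hn => ?_⟩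
  have := hK (n % P) (n / P) ((hb _ (Finset.mem_range.2 (Nat.mod_lt n hP))).trans
    ((Nat.le_div_iff_mul_le hP).2 hn))
  rwa [Nat.mod_add_div'] at this

namespace IsMixing

variable {V : Type*} {H : Finset V} {η : ℝ} {κ : ℕ} {w : ℕ → V → V → ℝ}

/-- Scalars that are repeatedly averaged with mixing weights, up to vanishing errors, agree in the
limit. -/
theorem tendsto_sup_sub_inf [Fintype V] (hw : IsMixing H η κ w) (hκ : 0 < κ) (hH : H.Nonempty)
    {ξ : ℕ → V → ℝ} {e : ℕ → ℝ} (he : Tendsto e atTop (𝓝 0))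
    (hξ : ∀ t, ∀ i ∈ H, |ξ (t + 1) i - ∑ j ∈ H, w t i j * ξ t j| ≤ e t) :
    Tendsto (fun t => H.sup' hH (ξ t) - H.inf' hH (ξ t)) atTop (𝓝 0) := by
  classical
  obtain ⟨L, hL⟩ := hw.exists_propagation
  have hη1 := hw.le_one hH
  set c : ℕ → ℝ := fun t => H.sup' hH (ξ t) - H.inf' hH (ξ t) with hcdef
  set E : ℕ → ℕ → ℝ := fun t s => ∑ k ∈ Finset.Ico t s, e k with hE
  have he0 : ∀ t, 0 ≤ e t := fun t => by
    obtain ⟨i, hi⟩ := hH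
    exact (abs_nonneg _).trans (hξ t i hi)
  have hlo : ∀ t, ∀ i ∈ H, H.inf' hH (ξ t) ≤ ξ t i := fun t i hi => Finset.inf'_le _ hi
  have hhi : ∀ t, ∀ i ∈ H, ξ t i ≤ H.sup' hH (ξ t) := fun t i hi => Finset.le_sup' _ hi
  have hc : ∀ t, 0 ≤ c t := fun t => by
    obtain ⟨i, hi⟩ := hH
    have := hlo t i hi
    have := hhi t i hi
    simp only [hcdef]
    linarith
  have hEs : ∀ t s, t ≤ s → E t (s + 1) = E t s + e s := fun t s hs => by
    rw [hE]
    exact Finset.sum_Ico_succ_top hs e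
  -- The distances to the minimum and to the maximum at time `t`, corrected by the accumulated
  -- errors, are both superaveraging. Using the same root `r` for both, the two gains add up to `η ^
  -- L * c t`.
  have hstep : ∀ t, c (t + L) ≤ (1 - η ^ L) * c t + 2 * E t (t + L) := by
    intro t
    obtain ⟨R, hRH, hRκ, hR⟩ := hL t
    obtain ⟨r, hr⟩ := Finset.card_pos.1 (hκ.trans_le hRκ)
    have hlow := hR (fun s i => ξ s i - H.inf' hH (ξ t) + E t s) (fun s hs i hi => by
      have h1 := abs_le.1 (hξ s i hi)
      simp_rw [mul_add, mul_sub, Finset.sum_add_distrib, Finset.sum_sub_distrib,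
        ← Finset.sum_mul, hw.sum_one s i hi, hEs t s hs]
      linarith) (fun i hi => by
      have := hlo t i hi
      simp only [hE, Finset.Ico_self, Finset.sum_empty]
      linarith) r hr
    have hupp := hR (fun s i => H.sup' hH (ξ t) - ξ s i + E t s) (fun s hs i hi => by
      have h1 := abs_le.1 (hξ s i hi)
      simp_rw [mul_add, mul_sub, Finset.sum_add_distrib, Finset.sum_sub_distrib,
        ← Finset.sum_mul, hw.sum_one s i hi, hEs t s hs]
      linarith) (fun i hi => by
      have := hhi t i hi
      simp only [hE, Finset.Ico_self, Finset.sum_empty]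
      linarith) r hr
    simp only [show E t t = 0 by simp [hE], add_zero] at hlow hupp
    obtain ⟨i, hi, hie⟩ := Finset.exists_mem_eq_sup' hH (ξ (t + L))
    obtain ⟨j, hj, hje⟩ := Finset.exists_mem_eq_inf' hH (ξ (t + L))
    have h1 := hlow j hj
    have h2 := hupp i hi
    simp only [hcdef]
    rw [hie, hje]
    linarith
  -- One additional step makes the period positive even if `L = 0`.
  have hP : ∀ t, c (t + (L + 1)) ≤ (1 - η ^ L) * c t + (2 * E t (t + L) + 2 * e (t + L)) := by
    intro t
    refine le_trans ?_ (add_le_add_left (hstep t) (2 * e (t + L)) |>.trans_eq (by ring))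
    have hE1 : ∀ i ∈ H, ξ (t + (L + 1)) i ≤ H.sup' hH (ξ (t + L)) + e (t + L) ∧
        H.inf' hH (ξ (t + L)) - e (t + L) ≤ ξ (t + (L + 1)) i := by
      intro i hi
      have h1 := abs_le.1 (hξ (t + L) i hi)
      have h2 : ∑ j ∈ H, w (t + L) i j * ξ (t + L) j ≤ H.sup' hH (ξ (t + L)) := by
        calc _ ≤ ∑ j ∈ H, w (t + L) i j * H.sup' hH (ξ (t + L)) :=
              Finset.sum_le_sum fun j hj =>
                mul_le_mul_of_nonneg_left (hhi _ j hj) (hw.nonneg _ i hi j hj)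
          _ = _ := by rw [← Finset.sum_mul, hw.sum_one _ i hi, one_mul]
      have h3 : H.inf' hH (ξ (t + L)) ≤ ∑ j ∈ H, w (t + L) i j * ξ (t + L) j := by
        calc _ = ∑ j ∈ H, w (t + L) i j * H.inf' hH (ξ (t + L)) := by
              rw [← Finset.sum_mul, hw.sum_one _ i hi, one_mul]
          _ ≤ _ := Finset.sum_le_sum fun j hj =>
                mul_le_mul_of_nonneg_left (hlo _ j hj) (hw.nonneg _ i hi j hj)
      rw [← add_assoc]
      constructor <;> linarith
    have h1 := Finset.sup'_le hH _ fun i hi => (hE1 i hi).1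
    have h2 := Finset.le_inf' hH _ fun i hi => (hE1 i hi).2
    simp only [hcdef]
    linarith
  have hE0 : Tendsto (fun t => 2 * E t (t + L) + 2 * e (t + L)) atTop (𝓝 0) := by
    have h1 : Tendsto (fun t => ∑ k ∈ Finset.range L, e (t + k)) atTop (𝓝 0) := by
      have := tendsto_finsetSum (Finset.range L) fun k _ => (tendsto_add_atTop_iff_nat k).2 he
      simpa using this
    have h2 := (h1.const_mul 2).add (((tendsto_add_atTop_iff_nat L).2 he).const_mul 2)
    simp only [mul_zero, add_zero] at h2
    refine h2.congr fun t => ?_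
    simp only [hE]
    rw [Finset.sum_Ico_eq_sum_range, Nat.add_sub_cancel_left]
  refine tendsto_atTop_of_forall_residue (Nat.succ_pos L) fun r => ?_
  refine tendsto_zero_of_le_mul_add (q := 1 - η ^ L) ?_ ?_ (fun _ => hc _) (hE0.comp
    (tendsto_atTop_mono (f := fun k => k) (g := fun k => r + k * (L + 1)) (fun k => ?_) tendsto_id))
    fun k => ?_
  · have := pow_le_one₀ (n := L) hw.pos.le hη1
    linarith
  · have := pow_pos hw.pos L
    linarith
  · nlinarith
  · have := hP (r + k * (L + 1))
    simp only [Function.comp]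
    convert this using 2
    rw [Nat.succ_eq_add_one]
    ring

theorem tendsto_sub_of_averaging [Fintype V] {d : ℕ} (hw : IsMixing H η κ w) (hκ : 0 < κ)
    {x v : ℕ → V → EuclideanSpace ℝ (Fin d)} {e : ℕ → ℝ}
    (hv : ∀ t, ∀ i ∈ H, IsAveraging H (x t) (v t i) (w t i)) (he : Tendsto e atTop (𝓝 0))
    (hx : ∀ t, ∀ i ∈ H, ‖x (t + 1) i - v t i‖ ≤ e t) {i j : V} (hi : i ∈ H) (hj : j ∈ H) :
    Tendsto (fun t => x t i - x t j) atTop (𝓝 0) := by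
  have hcoord : ∀ k, Tendsto (fun t => (x t i - x t j) k) atTop (𝓝 0) := by
    intro k
    have hH : H.Nonempty := ⟨i, hi⟩
    have hlim := hw.tendsto_sup_sub_inf hκ hH (ξ := fun t i => x t i k) he (fun t i hi => by
      refine le_trans (le_of_eq ?_) ((PiLp.norm_apply_le _ k).trans (hx t i hi))
      rw [Real.norm_eq_abs, PiLp.sub_apply, ← (hv t i hi).sum_smul]
      simp)
    refine squeeze_zero_norm (fun t => ?_) hlim
    have h1 := fun i hi => Finset.le_sup' (s := H) (fun i => x t i k) (b := i) hi
    have h2 := fun i hi => Finset.inf'_le (s := H) (fun i => x t i k) (b := i) hi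
    have := h1 i hi
    have := h1 j hj
    have := h2 i hi
    have := h2 j hj
    rw [Real.norm_eq_abs, PiLp.sub_apply, abs_le]
    constructor <;> linarith
  have := (PiLp.continuous_toLp 2 fun _ : Fin d => ℝ).tendsto 0 |>.comp
    (tendsto_pi_nhds.2 hcoord)
  exact this

end IsMixing

/-! ### Consequences of redundancy -/

section Redundancy

variable {V : Type*} [Fintype V]

open scoped Classical in
-- Double counting: each agent belongs to `(n-1).choose (κ-1)` of the sets.
theorem sum_powersetCard_sum {κ : ℕ} (hκ : 0 < κ) (a : V → ℝ) :
    ∑ S ∈ (Finset.univ : Finset V).powersetCard κ, ∑ i ∈ S, a i =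
      (Fintype.card V - 1).choose (κ - 1) * ∑ i, a i := by
  have h : ∀ S ∈ (Finset.univ : Finset V).powersetCard κ, ∑ i ∈ S, a i =
      ∑ i, if i ∈ S then a i else 0 := fun S _ => by simp
  rw [Finset.sum_congr rfl h, Finset.sum_comm, Finset.mul_sum]
  refine Finset.sum_congr rfl fun i _ => ?_
  rw [← Finset.sum_filter, Finset.sum_const, nsmul_eq_mul]
  congr 2
  have hc : ((Finset.univ.erase i).powersetCard (κ - 1)).card =
      (Fintype.card V - 1).choose (κ - 1) := by
    rw [Finset.card_powersetCard, Finset.card_erase_of_mem (Finset.mem_univ i), Finset.card_univ]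
  rw [← hc]
  refine Finset.card_bij' (fun S _ => S.erase i) (fun S _ => insert i S) ?_ ?_ ?_ ?_
  · intro S hS
    simp only [Finset.mem_filter, Finset.mem_powersetCard] at hS ⊢
    exact ⟨Finset.erase_subset_erase i hS.1.1, by rw [Finset.card_erase_of_mem hS.2, hS.1.2]⟩
  · intro S hS
    simp only [Finset.mem_filter, Finset.mem_powersetCard] at hS ⊢
    have hi : i ∉ S := fun h => by simpa using hS.1 h
    exact ⟨⟨Finset.subset_univ _, by rw [Finset.card_insert_of_notMem hi, hS.2]; omega⟩,
      Finset.mem_insert_self i S⟩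
  · intro S hS
    exact Finset.insert_erase (Finset.mem_filter.1 hS).2
  · intro S hS
    refine Finset.erase_insert fun h => ?_
    simpa using (Finset.mem_powersetCard.1 hS).1 h

/-- If all sets of `κ` agents have the same nonempty set of aggregate minimizers, then so does the
whole network. -/
theorem argminSum_univ_eq {E : Type*} {f : V → E → ℝ} {κ : ℕ} (hκ : 0 < κ)
    (hκV : κ ≤ Fintype.card V) {M : Set E} (hM : M.Nonempty)
    (hfM : ∀ S : Finset V, S.card = κ → argminSum f S = M) :
    argminSum f Finset.univ = M := by
  have hchoose : (0 : ℝ) < (Fintype.card V - 1).choose (κ - 1) := by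
    exact_mod_cast Nat.choose_pos (by omega)
  have hmem : ∀ z ∈ M, ∀ S ∈ (Finset.univ : Finset V).powersetCard κ, z ∈ argminSum f S :=
    fun z hz S hS => by rwa [hfM S (Finset.mem_powersetCard.1 hS).2]
  have hsub : M ⊆ argminSum f Finset.univ := by
    intro z hz y
    have := Finset.sum_le_sum fun S hS => hmem z hz S hS y
    rw [sum_powersetCard_sum hκ fun i => f i z, sum_powersetCard_sum hκ fun i => f i y] at this
    exact le_of_mul_le_mul_left this hchoose
  refine Set.Subset.antisymm (fun z hz => ?_) hsub
  obtain ⟨z₀, hz₀⟩ := hM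
  -- A minimizer `z` of the total ties with `z₀`, while `z₀` is at least as good on every set; so
  -- they tie on each.
  have heq : ∑ S ∈ (Finset.univ : Finset V).powersetCard κ, ∑ i ∈ S, f i z₀ =
      ∑ S ∈ (Finset.univ : Finset V).powersetCard κ, ∑ i ∈ S, f i z := by
    rw [sum_powersetCard_sum hκ fun i => f i z₀, sum_powersetCard_sum hκ fun i => f i z,
      le_antisymm (hsub hz₀ z) (hz z₀)]
  obtain ⟨S, hS⟩ := Finset.powersetCard_nonempty.2
    (show κ ≤ (Finset.univ : Finset V).card by rwa [Finset.card_univ])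
  have hSz := (Finset.sum_eq_sum_iff_of_le fun S hS => hmem z₀ hz₀ S hS z).1 heq S hS
  rw [← hfM S (Finset.mem_powersetCard.1 hS).2]
  intro y
  rw [← hSz]
  exact hmem z₀ hz₀ S hS y

/-- If all sets of `κ < |V|` agents have the same set of aggregate minimizers, then each objective is
constant on it. -/
theorem eq_of_mem_of_forall_argminSum_eq {E : Type*} {f : V → E → ℝ} {κ : ℕ} (hκ : 0 < κ)
    (hκV : κ < Fintype.card V) {M : Set E}
    (hfM : ∀ S : Finset V, S.card = κ → argminSum f S = M) {a b : E} (ha : a ∈ M) (hb : b ∈ M)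
    (i : V) : f i a = f i b := by
  classical
  have hS : ∀ S : Finset V, S.card = κ → ∑ j ∈ S, (f j a - f j b) = 0 := by
    intro S hS
    have h1 : a ∈ argminSum f S := by rwa [hfM S hS]
    have h2 : b ∈ argminSum f S := by rwa [hfM S hS]
    rw [Finset.sum_sub_distrib, sub_eq_zero]
    exact le_antisymm (h1 b) (h2 a)
  have hij : ∀ j, f j a - f j b = f i a - f i b := by
    intro j
    rcases eq_or_ne j i with rfl | hne
    · rfl
    -- Exchanging `i` for `j` next to a common `T` needs `κ - 1` agents other than both, which exist
    -- because `κ < |V|`.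
    obtain ⟨T, hT, hTc⟩ := Finset.exists_subset_card_eq (s := (Finset.univ.erase i).erase j)
      (n := κ - 1) (by
        rw [Finset.card_erase_of_mem (by simpa using hne),
          Finset.card_erase_of_mem (Finset.mem_univ i), Finset.card_univ]
        omega)
    have hi : i ∉ T := fun h => by simpa using hT h
    have hj : j ∉ T := fun h => by simpa using hT h
    have h1 := hS (insert i T) (by rw [Finset.card_insert_of_notMem hi]; omega)
    have h2 := hS (insert j T) (by rw [Finset.card_insert_of_notMem hj]; omega)
    rw [Finset.sum_insert hi] at h1
    rw [Finset.sum_insert hj] at h2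
    linarith
  obtain ⟨S, -, hSc⟩ := Finset.exists_subset_card_eq (s := (Finset.univ : Finset V)) (n := κ)
    (by rw [Finset.card_univ]; omega)
  have := hS S hSc
  rw [Finset.sum_congr rfl fun j _ => hij j, Finset.sum_const, hSc, nsmul_eq_mul, mul_eq_zero] at this
  have hne : (κ : ℝ) ≠ 0 := by positivity
  linarith [this.resolve_left hne]

/-- If moreover the objectives are convex and the common set of minimizers has nonempty interior,
then it minimizes each objective. -/
theorem le_of_mem_of_forall_argminSum_eq {E : Type*} [NormedAddCommGroup E] [NormedSpace ℝ E]
    {f : V → E → ℝ} (hf : ∀ i, ConvexOn ℝ Set.univ (f i)) {κ : ℕ} (hκ : 0 < κ)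
    (hκV : κ < Fintype.card V) {M : Set E} (hM : (interior M).Nonempty)
    (hfM : ∀ S : Finset V, S.card = κ → argminSum f S = M) {z : E} (hz : z ∈ M) (i : V) (y : E) :
    f i z ≤ f i y := by
  obtain ⟨z₀, hz₀⟩ := hM
  rw [eq_of_mem_of_forall_argminSum_eq hκ hκV hfM hz (interior_subset hz₀) i]
  refine IsMinOn.of_isLocalMin_of_convex_univ ?_ (hf i) y
  filter_upwards [isOpen_interior.mem_nhds hz₀] with a ha
  exact (eq_of_mem_of_forall_argminSum_eq hκ hκV hfM (interior_subset hz₀) (interior_subset ha) i).le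

end Redundancy

/-! ### Decrease of averaged quantities -/

namespace IsMixing

variable {V : Type*} {H : Finset V} {η : ℝ} {κ : ℕ} {w : ℕ → V → V → ℝ}

/-- Raising the ceiling `m` by the accumulated errors turns the deficit below it into a
superaveraging quantity, with the decrement `h` as surplus. -/
theorem superaveraging_deficit (hw : IsMixing H η κ w) {a h : ℕ → V → ℝ} {e : ℕ → ℝ}
    (ha : ∀ t, ∀ i ∈ H, a (t + 1) i ≤ ∑ j ∈ H, w t i j * a t j - h t i + e t) (m : ℝ) (t s : ℕ)
    (hs : t ≤ s) (i : V) (hi : i ∈ H) :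
    ∑ j ∈ H, w s i j * (m + ∑ k ∈ Finset.Ico t s, e k - a s j) + h s i ≤
      m + ∑ k ∈ Finset.Ico t (s + 1), e k - a (s + 1) i := by
  have h1 := ha s i hi
  rw [Finset.sum_Ico_succ_top hs]
  simp_rw [mul_sub, Finset.sum_sub_distrib, ← Finset.sum_mul, hw.sum_one s i hi]
  linarith

theorem le_add_sum (hw : IsMixing H η κ w) {a h : ℕ → V → ℝ} {e : ℕ → ℝ}
    (hh : ∀ t, ∀ i ∈ H, 0 ≤ h t i)
    (ha : ∀ t, ∀ i ∈ H, a (t + 1) i ≤ ∑ j ∈ H, w t i j * a t j - h t i + e t) {m : ℝ} {t : ℕ}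
    (hm : ∀ i ∈ H, a t i ≤ m) {s : ℕ} (hs : t ≤ s) :
    ∀ i ∈ H, a s i ≤ m + ∑ k ∈ Finset.Ico t s, e k := by
  intro i hi
  have := hw.nonneg_of_superaveraging
    (u := fun s i => m + ∑ k ∈ Finset.Ico t s, e k - a s i) (t := t)
    (fun s hs i hi => by
      have := hw.superaveraging_deficit ha m t s hs i hi
      have := hh s i hi
      linarith) (fun i hi => by simpa using hm i hi) hs i hi
  linarith

/-- The decrements at some `κ` vertices lower the values at all vertices after a fixed time. -/
theorem exists_decrease [Fintype V] (hw : IsMixing H η κ w) (hκ : 0 < κ) :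
    ∃ (P : ℕ) (c : ℝ), 0 < P ∧ 0 < c ∧ ∀ t, ∃ S ⊆ H, S.card = κ ∧
      ∀ (a h : ℕ → V → ℝ) (e : ℕ → ℝ), (∀ t, ∀ i ∈ H, 0 ≤ h t i) →
      (∀ t, ∀ i ∈ H, a (t + 1) i ≤ ∑ j ∈ H, w t i j * a t j - h t i + e t) →
      ∀ m : ℝ, (∀ i ∈ H, a t i ≤ m) → ∀ i ∈ H,
        a (t + P) i ≤ m + ∑ k ∈ Finset.Ico t (t + P), e k - c * ∑ r ∈ S, h t r := by
  obtain ⟨L, hL⟩ := hw.exists_propagation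
  have hη := pow_pos hw.pos L
  have hκ' : (0 : ℝ) < κ := by exact_mod_cast hκ
  -- One step turns the decrements into deficits, and `L` more spread them. Each of the `κ` vertices
  -- gives a lower bound for the same deficit; the division by `κ` averages these.
  refine ⟨1 + L, η ^ L / κ, by omega, by positivity, fun t => ?_⟩
  obtain ⟨R, hRH, hRκ, hR⟩ := hL (t + 1)
  obtain ⟨S, hSR, hSκ⟩ := Finset.exists_subset_card_eq hRκ
  refine ⟨S, hSR.trans hRH, hSκ, fun a h e hh ha m hm i hi => ?_⟩
  have hdef := hw.superaveraging_deficit ha m t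
  have hnn := fun s => hw.nonneg_of_superaveraging (s := s)
    (u := fun s i => m + ∑ k ∈ Finset.Ico t s, e k - a s i) (t := t)
    (fun s hs i hi => by
      have := hdef s hs i hi
      have := hh s i hi
      linarith) (fun i hi => by simpa using hm i hi)
  have hprop := hR (fun s i => m + ∑ k ∈ Finset.Ico t s, e k - a s i)
    (fun s hs i hi => by
      have := hdef s (by omega) i hi
      have := hh s i hi
      linarith) (hnn _ (Nat.le_succ t))
  have hr : ∀ r ∈ S, η ^ L * h t r ≤
      m + ∑ k ∈ Finset.Ico t (t + (1 + L)), e k - a (t + (1 + L)) i := by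
    intro r hr
    have h1 := hprop r (hSR hr) i hi
    have h2 := hdef t le_rfl r (hRH (hSR hr))
    have h3 : 0 ≤ ∑ j ∈ H, w t r j * (m + ∑ k ∈ Finset.Ico t t, e k - a t j) :=
      Finset.sum_nonneg fun j hj => mul_nonneg (hw.nonneg t r (hRH (hSR hr)) j hj)
        (hnn _ le_rfl j hj)
    rw [← add_assoc]
    refine le_trans (mul_le_mul_of_nonneg_left ?_ hη.le) h1
    linarith
  have hsum := Finset.sum_le_sum hr
  rw [← Finset.mul_sum, Finset.sum_const, hSκ, nsmul_eq_mul] at hsum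
  rw [div_mul_eq_mul_div]
  have : η ^ L * ∑ r ∈ S, h t r ≤ (m + ∑ k ∈ Finset.Ico t (t + (1 + L)), e k -
      a (t + (1 + L)) i) * κ := by linarith
  have := (div_le_iff₀ hκ').2 this
  linarith

end IsMixing

theorem sum_range_mul_le_of_antitone {α : ℕ → ℝ} (hα : Antitone α) (P n : ℕ) :
    ∑ t ∈ Finset.range (n * P), α t ≤ P * ∑ l ∈ Finset.range n, α (l * P) := by
  induction n with
  | zero => simp
  | succ n ih =>
    rw [Nat.succ_mul, Finset.sum_range_add, Finset.sum_range_succ, mul_add]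
    have : ∑ k ∈ Finset.range P, α (n * P + k) ≤ P * α (n * P) := by
      calc _ ≤ ∑ k ∈ Finset.range P, α (n * P) :=
            Finset.sum_le_sum fun k _ => hα (Nat.le_add_right _ _)
        _ = _ := by simp
    linarith

namespace IsMixing

variable {V : Type*} {H : Finset V} {η : ℝ} {κ : ℕ} {w : ℕ → V → V → ℝ}

/-- Nonnegative quantities cannot lose a non-summable amount, so the loss rates at some `κ` vertices
are small infinitely often. -/
theorem exists_sum_lt [Fintype V] (hw : IsMixing H η κ w) (hκ : 0 < κ) (hH : H.Nonempty)
    {α : ℕ → ℝ} (hα_pos : ∀ t, 0 < α t) (hα_anti : Antitone α)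
    (hα_sum : Tendsto (fun T : ℕ => ∑ t ∈ Finset.range T, α t) atTop atTop)
    {a ρ : ℕ → V → ℝ} {e : ℕ → ℝ} (he0 : ∀ t, 0 ≤ e t) (he : Summable e)
    (ha0 : ∀ t, ∀ i ∈ H, 0 ≤ a t i) (hρ : ∀ t, ∀ i ∈ H, 0 ≤ ρ t i)
    (ha : ∀ t, ∀ i ∈ H, a (t + 1) i ≤ ∑ j ∈ H, w t i j * a t j - α t * ρ t i + e t)
    {ε : ℝ} (hε : 0 < ε) (T : ℕ) : ∃ t ≥ T, ∃ S ⊆ H, S.card = κ ∧ ∑ r ∈ S, ρ t r < ε := by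
  by_contra! hcon
  obtain ⟨P, c, hP, hc, hdec⟩ := hw.exists_decrease hκ
  have hh : ∀ t, ∀ i ∈ H, 0 ≤ α t * ρ t i := fun t i hi => mul_nonneg (hα_pos t).le (hρ t i hi)
  have hbound : ∀ n, ∀ i ∈ H, a (T + n * P) i ≤ H.sup' hH (a T) +
      ∑ k ∈ Finset.Ico T (T + n * P), e k - c * ε * ∑ l ∈ Finset.range n, α (T + l * P) := by
    intro n
    induction n with
    | zero =>
      intro i hi
      simpa using ⟨i, hi, le_rfl⟩
    | succ n ih =>
      intro i hi
      obtain ⟨S, hSH, hSκ, hS⟩ := hdec (T + n * P)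
      have h1 := hS a (fun t i => α t * ρ t i) e hh ha _ ih i hi
      have h2 := hcon (T + n * P) (Nat.le_add_right _ _) S hSH hSκ
      have h3 := mul_le_mul_of_nonneg_left h2 (mul_pos hc (hα_pos (T + n * P))).le
      rw [Finset.sum_range_succ, Nat.succ_mul, ← add_assoc,
        ← Finset.sum_Ico_consecutive e (Nat.le_add_right T (n * P)) (Nat.le_add_right _ P)]
      rw [← Finset.mul_sum] at h1
      linarith
  have hesum : ∀ n, ∑ k ∈ Finset.Ico T (T + n * P), e k ≤ ∑' k, e k := fun n =>
    he.sum_le_tsum _ fun k _ => he0 k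
  have hT : Tendsto (fun n => ∑ t ∈ Finset.range n, α (t + T)) atTop atTop := by
    have h1 := (tendsto_add_atTop_iff_nat T).2 hα_sum
    have h2 := tendsto_atTop_add_const_left atTop (-∑ t ∈ Finset.range T, α t) h1
    refine h2.congr fun n => ?_
    rw [add_comm n T, Finset.sum_range_add]
    simp [add_comm]
  have hP' : (0 : ℝ) < P := by exact_mod_cast hP
  obtain ⟨N, hN⟩ := (hT.eventually_ge_atTop
    (P * ((H.sup' hH (a T) + ∑' k, e k + 1) / (c * ε)))).exists_forall_of_atTop
  have h1 := hN (N * P) (Nat.le_mul_of_pos_right N hP)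
  -- The losses are seen only once per window; monotonicity of the stepsizes makes their sampled sum
  -- diverge too.
  have h2 := sum_range_mul_le_of_antitone (α := fun t => α (t + T))
    (fun s t hst => hα_anti (Nat.add_le_add_right hst T)) P N
  have h3 := le_of_mul_le_mul_left (h1.trans h2) hP'
  rw [div_le_iff₀ (by positivity)] at h3
  obtain ⟨i, hi⟩ := hH
  have h4 := hbound N i hi
  have h5 := ha0 (T + N * P) i hi
  have h6 := hesum N
  simp_rw [add_comm _ T] at h3
  linarith

end IsMixing

/-! ### Convergence of mixing subgradient iterations -/

section Convergence

variable {V : Type*} {d : ℕ} {f : V → EuclideanSpace ℝ (Fin d) → ℝ}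
  {g : V → EuclideanSpace ℝ (Fin d) → EuclideanSpace ℝ (Fin d)} {D : ℝ}

theorem IsSubgradient.sub_le {h : EuclideanSpace ℝ (Fin d) → ℝ} {x u : EuclideanSpace ℝ (Fin d)}
    (hu : IsSubgradient h x u) (huD : ‖u‖ ≤ D) (y : EuclideanSpace ℝ (Fin d)) :
    h x - h y ≤ D * ‖x - y‖ := by
  have h1 := hu y
  have h2 := abs_le.1 ((abs_real_inner_le_norm u (y - x)).trans
    (mul_le_mul_of_nonneg_right huD (norm_nonneg _)))
  rw [norm_sub_rev y x] at h2
  linarith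

theorem continuous_of_bounded_subgradients {h : EuclideanSpace ℝ (Fin d) → ℝ}
    {u : EuclideanSpace ℝ (Fin d) → EuclideanSpace ℝ (Fin d)}
    (hu : ∀ x, IsSubgradient h x (u x)) (huD : ∀ x, ‖u x‖ ≤ D) : Continuous h := by
  refine (LipschitzWith.of_le_add_mul D.toNNReal fun x y => ?_).continuous
  have := (hu x).sub_le (huD x) y
  rw [Real.coe_toNNReal D ((norm_nonneg _).trans (huD x)), dist_eq_norm]
  linarith

theorem IsAveraging.norm_sub_sq_le {H : Finset V} {p : V → EuclideanSpace ℝ (Fin d)}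
    {q : EuclideanSpace ℝ (Fin d)} {w : V → ℝ} (hw : IsAveraging H p q w)
    (z : EuclideanSpace ℝ (Fin d)) : ‖q - z‖ ^ 2 ≤ ∑ j ∈ H, w j * ‖p j - z‖ ^ 2 := by
  have hconv : ConvexOn ℝ Set.univ fun a : EuclideanSpace ℝ (Fin d) => ‖a‖ ^ 2 :=
    convexOn_univ_norm.pow (fun _ _ => norm_nonneg _) 2
  have := hconv.map_sum_le (p := fun j => p j - z) hw.nonneg hw.sum_one fun _ _ => Set.mem_univ _
  simp_rw [smul_sub, Finset.sum_sub_distrib, ← Finset.sum_smul, hw.sum_one, hw.sum_smul,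
    one_smul, smul_eq_mul] at this
  exact this

theorem IsAveraging.norm_sub_le {H : Finset V} {p : V → EuclideanSpace ℝ (Fin d)}
    {q : EuclideanSpace ℝ (Fin d)} {w : V → ℝ} (hw : IsAveraging H p q w)
    (z : EuclideanSpace ℝ (Fin d)) : ‖q - z‖ ≤ ∑ j ∈ H, ‖p j - z‖ := by
  have hq : q - z = ∑ j ∈ H, w j • (p j - z) := by
    simp_rw [smul_sub, Finset.sum_sub_distrib, ← Finset.sum_smul, hw.sum_one, hw.sum_smul, one_smul]
  rw [hq]
  refine (norm_sum_le _ _).trans (Finset.sum_le_sum fun j hj => ?_)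
  have hj0 := hw.nonneg j hj
  rw [norm_smul, Real.norm_of_nonneg hj0]
  refine mul_le_of_le_one_left (norm_nonneg _) ?_
  rw [← hw.sum_one]
  exact Finset.single_le_sum (fun j hj => hw.nonneg j hj) hj

/-- Expanding the square, the subgradient inequality controls the cross term. -/
theorem norm_sq_subgradient_step_le {h : EuclideanSpace ℝ (Fin d) → ℝ}
    {q u : EuclideanSpace ℝ (Fin d)} (hu : IsSubgradient h q u) (huD : ‖u‖ ≤ D) {a : ℝ}
    (ha : 0 ≤ a) (z : EuclideanSpace ℝ (Fin d)) :
    ‖q - a • u - z‖ ^ 2 ≤ ‖q - z‖ ^ 2 - a * (2 * (h q - h z)) + D ^ 2 * a ^ 2 := by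
  have h1 := hu z
  rw [show q - a • u - z = (q - z) - a • u by abel, norm_sub_sq_real, inner_smul_right, norm_smul,
    Real.norm_of_nonneg ha, mul_pow, real_inner_comm]
  have h2 : inner ℝ u (z - q) = -inner ℝ u (q - z) := by
    rw [← inner_neg_right, neg_sub]
  have h3 : a ^ 2 * ‖u‖ ^ 2 ≤ a ^ 2 * D ^ 2 := by gcongr
  have h4 := mul_le_mul_of_nonneg_left (show h q - h z ≤ inner ℝ u (q - z) by linarith) ha
  linarith

/-- Mixing subgradient iterations converge to a common point of `M` if `M` minimizes every
objective as well as the aggregate objective of any `κ` agents. -/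
theorem IsMixing.exists_tendsto [Fintype V] {H : Finset V} {η : ℝ} {κ : ℕ} {w : ℕ → V → V → ℝ}
    (hw : IsMixing H η κ w) (hκ : 0 < κ) (hκV : κ ≤ Fintype.card V) (hH : H.Nonempty)
    {α : ℕ → ℝ} (hα_pos : ∀ t, 0 < α t) (hα_anti : Antitone α)
    (hα_sum : Tendsto (fun T : ℕ => ∑ t ∈ Finset.range T, α t) atTop atTop)
    (hα_sq : Summable fun t => α t ^ 2)
    (hg : ∀ i x, IsSubgradient (f i) x (g i x)) (hD : ∀ i x, ‖g i x‖ ≤ D)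
    {x v : ℕ → V → EuclideanSpace ℝ (Fin d)}
    (hv : ∀ t, ∀ i ∈ H, IsAveraging H (x t) (v t i) (w t i))
    (hx : ∀ t, ∀ i ∈ H, x (t + 1) i = v t i - α t • g i (v t i))
    {M : Set (EuclideanSpace ℝ (Fin d))} (hM : M.Nonempty)
    (hfM : ∀ S : Finset V, S.card = κ → argminSum f S = M)
    (hmin : ∀ z ∈ M, ∀ i y, f i z ≤ f i y) :
    ∃ p ∈ M, ∀ i ∈ H, Tendsto (fun t => x t i) atTop (𝓝 p) := by
  obtain ⟨i₀, hi₀⟩ := hH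
  obtain ⟨z, hz⟩ := hM
  have hD0 : 0 ≤ D := (norm_nonneg _).trans (hD i₀ z)
  have hα0 : Tendsto α atTop (𝓝 0) := by
    have := (Real.continuous_sqrt.tendsto 0).comp hα_sq.tendsto_atTop_zero
    rw [Real.sqrt_zero] at this
    exact this.congr fun t => Real.sqrt_sq (hα_pos t).le
  have hdiff : ∀ i ∈ H, Tendsto (fun t => x t i - x t i₀) atTop (𝓝 0) := fun i hi => by
    refine hw.tendsto_sub_of_averaging hκ hv (e := fun t => α t * D)
      (by simpa using hα0.mul_const D) (fun t i hi => ?_) hi hi₀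
    rw [hx t i hi, sub_sub_cancel_left, norm_neg, norm_smul, Real.norm_of_nonneg (hα_pos t).le]
    exact mul_le_mul_of_nonneg_left (hD _ _) (hα_pos t).le
  set δ : ℕ → ℝ := fun t => ∑ j ∈ H, ‖x t j - x t i₀‖ with hδ
  have hδ0 : Tendsto δ atTop (𝓝 0) := by
    simpa using tendsto_finsetSum H fun j hj => (hdiff j hj).norm
  set e : ℕ → ℝ := fun t => D ^ 2 * α t ^ 2 with he
  have he0 : ∀ t, 0 ≤ e t := fun t => by positivity
  have hes : Summable e := hα_sq.mul_left _
  have hrec : ∀ p ∈ M, ∀ t, ∀ i ∈ H, ‖x (t + 1) i - p‖ ^ 2 ≤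
      ∑ j ∈ H, w t i j * ‖x t j - p‖ ^ 2 - α t * (2 * (f i (v t i) - f i p)) + e t := by
    intro p hp t i hi
    rw [hx t i hi]
    have h1 := norm_sq_subgradient_step_le (hg i (v t i)) (hD _ _) (hα_pos t).le p
    have h2 := (hv t i hi).norm_sub_sq_le p
    simp only [he]
    linarith
  have hρ : ∀ p ∈ M, ∀ t, ∀ i ∈ H, 0 ≤ 2 * (f i (v t i) - f i p) := fun p hp t i hi => by
    have := hmin p hp i (v t i)
    linarith
  have hquasi : ∀ p ∈ M, ∀ t m, (∀ i ∈ H, ‖x t i - p‖ ^ 2 ≤ m) → ∀ s ≥ t, ∀ i ∈ H,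
      ‖x s i - p‖ ^ 2 ≤ m + ∑ k ∈ Finset.Ico t s, e k := fun p hp t m hm s hs =>
    hw.le_add_sum (a := fun t i => ‖x t i - p‖ ^ 2)
      (fun t i hi => mul_nonneg (hα_pos t).le (hρ p hp t i hi)) (hrec p hp) hm hs
  have hne : ((Finset.univ : Finset V).powersetCard κ).Nonempty :=
    Finset.powersetCard_nonempty.2 (by rwa [Finset.card_univ])
  -- The good set of `κ` agents varies with time. The minimum over all such sets is a continuous
  -- substitute, and where it is nonpositive some aggregate is minimized.
  set F : EuclideanSpace ℝ (Fin d) → ℝ := fun a =>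
    ((Finset.univ : Finset V).powersetCard κ).inf' hne fun S => ∑ i ∈ S, (f i a - f i z) with hF
  have hFc : Continuous F := by
    refine Continuous.finset_inf'_apply hne fun S _ => continuous_finsetSum S fun i _ => ?_
    exact (continuous_of_bounded_subgradients (hg i) (hD i)).sub continuous_const
  have hsmall : ∀ k : ℕ, ∃ t ≥ k, F (x t i₀) < 1 / ((k : ℝ) + 1) := by
    intro k
    have hk : (0 : ℝ) < 1 / ((k : ℝ) + 1) := by positivity
    have hlim : Tendsto (fun t => κ * (D * δ t)) atTop (𝓝 0) := by
      simpa using (hδ0.const_mul D).const_mul (κ : ℝ)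
    obtain ⟨T, hT⟩ := (hlim.eventually (gt_mem_nhds (half_pos hk))).exists_forall_of_atTop
    obtain ⟨t, ht, S, hSH, hSκ, hS⟩ := hw.exists_sum_lt hκ ⟨i₀, hi₀⟩ hα_pos hα_anti hα_sum
      (a := fun t i => ‖x t i - z‖ ^ 2) he0 hes (fun _ _ _ => by positivity) (hρ z hz) (hrec z hz)
      hk (max k T)
    refine ⟨t, (le_max_left _ _).trans ht, ?_⟩
    have hle : F (x t i₀) ≤ ∑ i ∈ S, (f i (x t i₀) - f i z) :=
      Finset.inf'_le _ (Finset.mem_powersetCard.2 ⟨Finset.subset_univ S, hSκ⟩)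
    have hle' : ∑ i ∈ S, (f i (x t i₀) - f i z) ≤
        ∑ i ∈ S, (2 * (f i (v t i) - f i z) / 2 + D * δ t) := by
      -- The gaps are known at `v t i` only; bounded subgradients move them to `x t i₀` at a cost of
      -- `D * δ t`.
      refine Finset.sum_le_sum fun i hi => ?_
      have h1 := (hg i (x t i₀)).sub_le (hD _ _) (v t i)
      have h2 := (hv t i (hSH hi)).norm_sub_le (x t i₀)
      rw [norm_sub_rev] at h2
      have h3 := mul_le_mul_of_nonneg_left h2 hD0
      simp only [hδ]
      linarith
    rw [Finset.sum_add_distrib, ← Finset.sum_div, Finset.sum_const, hSκ, nsmul_eq_mul] at hle'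
    have := hT t ((le_max_right _ _).trans ht)
    linarith
  choose τ hτ hτF using hsmall
  have hbdd : ∀ k, x (τ k) i₀ ∈ Metric.closedBall z
      (Real.sqrt (∑ i ∈ H, ‖x 0 i - z‖ ^ 2 + ∑' k, e k)) := by
    intro k
    rw [Metric.mem_closedBall, dist_eq_norm]
    refine Real.le_sqrt_of_sq_le ?_
    refine (hquasi z hz 0 _ (fun i hi => ?_) (τ k) (Nat.zero_le _) i₀ hi₀).trans
      (add_le_add_right (hes.sum_le_tsum _ fun k _ => he0 k) _)
    exact Finset.single_le_sum (f := fun i => ‖x 0 i - z‖ ^ 2) (fun _ _ => by positivity) hi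
  obtain ⟨p, -, φ, hφ, hp⟩ := tendsto_subseq_of_bounded Metric.isBounded_closedBall hbdd
  have hτφ : Tendsto (fun k => τ (φ k)) atTop atTop :=
    tendsto_atTop_mono (fun k => (hφ.id_le k).trans (hτ (φ k))) tendsto_id
  have hFp : F p ≤ 0 := by
    refine le_of_tendsto_of_tendsto' ((hFc.tendsto p).comp hp)
      (tendsto_one_div_add_atTop_nhds_zero_nat.comp hφ.tendsto_atTop) fun k => ?_
    exact (hτF (φ k)).le
  have hpM : p ∈ M := by
    obtain ⟨S, hS, hSF⟩ := Finset.exists_mem_eq_inf' hne fun S => ∑ i ∈ S, (f i p - f i z)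
    have h1 : ∑ i ∈ S, (f i p - f i z) ≤ 0 := hSF ▸ hFp
    rw [Finset.sum_sub_distrib] at h1
    rw [← hfM S (Finset.mem_powersetCard.1 hS).2]
    intro y
    have h2 := Finset.sum_le_sum fun i (_ : i ∈ S) => hmin z hz i y
    linarith
  refine ⟨p, hpM, fun i hi => ?_⟩
  have hall : ∀ i ∈ H, Tendsto (fun k => ‖x (τ (φ k)) i - p‖ ^ 2) atTop (𝓝 0) := by
    intro i hi
    have h1 := ((hdiff i hi).comp hτφ).add hp
    rw [zero_add] at h1
    have h2 := ((h1.sub_const p).norm).pow 2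
    simpa using h2
  -- At a time when this quantity is below `ε`, it bounds all later squared distances to `p`: the
  -- tail pays for every future error.
  have hsum : Tendsto (fun k => ∑ i ∈ H, ‖x (τ (φ k)) i - p‖ ^ 2 +
      ∑' l, e (l + τ (φ k))) atTop (𝓝 0) := by
    have h1 := tendsto_finsetSum H hall
    have h2 := (tendsto_sum_nat_add e).comp hτφ
    simpa using h1.add h2
  have hsq : Tendsto (fun t => ‖x t i - p‖ ^ 2) atTop (𝓝 0) := by
    rw [Metric.tendsto_atTop]
    intro ε hε
    obtain ⟨k, hk⟩ := (hsum.eventually (gt_mem_nhds hε)).exists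
    refine ⟨τ (φ k), fun t ht => ?_⟩
    rw [Real.dist_eq, sub_zero, abs_of_nonneg (by positivity)]
    refine lt_of_le_of_lt ?_ hk
    refine (hquasi p hpM (τ (φ k)) _ (fun i hi => ?_) t ht i hi).trans (add_le_add_right ?_ _)
    · exact Finset.single_le_sum (f := fun i => ‖x (τ (φ k)) i - p‖ ^ 2)
        (fun _ _ => by positivity) hi
    · rw [Finset.sum_Ico_eq_sum_range]
      simp_rw [add_comm (τ (φ k))]
      exact ((summable_nat_add_iff (τ (φ k))).2 hes).sum_le_tsum _ fun l _ => he0 _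
  rw [tendsto_iff_norm_sub_tendsto_zero]
  have := (Real.continuous_sqrt.tendsto 0).comp hsq
  rw [Real.sqrt_zero] at this
  exact this.congr fun t => Real.sqrt_sq (norm_nonneg _)

end Convergence

/-! ### Assembly -/

theorem IsRun.exists_tendsto_of_card_eq {V : Type*} [Fintype V] {d : ℕ} {G : Digraph V} {β : ℕ}
    {byz : Finset V} (hbyz : byz.card = β) (hd : 0 < d)
    {f : V → EuclideanSpace ℝ (Fin d) → ℝ} (hf : ∀ i, ConvexOn ℝ Set.univ (f i))
    (hint : (interior (argminSum f Finset.univ)).Nonempty)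
    {g : V → EuclideanSpace ℝ (Fin d) → EuclideanSpace ℝ (Fin d)}
    (hg : ∀ i x, IsSubgradient (f i) x (g i x))
    (hD : ∃ D : ℝ, 0 < D ∧ ∀ i x, ‖g i x‖ ≤ D)
    {α : ℕ → ℝ} (hα_pos : ∀ t, 0 < α t) (hα_anti : Antitone α)
    (hα_sum : Tendsto (fun T : ℕ => ∑ t ∈ Finset.range T, α t) atTop atTop)
    (hα_sq : Summable fun t => α t ^ 2)
    (hG : Resilient G β (d * β))
    (hred : Redundant f (Fintype.card V - kappa G β (d * β)))
    (hκ : kappa G β (d * β) < Fintype.card V)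
    (hmin : ∀ S : Finset V, S.card = kappa G β (d * β) → (argminSum f S).Nonempty)
    {x : ℕ → V → EuclideanSpace ℝ (Fin d)} {msg : ℕ → V → V → EuclideanSpace ℝ (Fin d)}
    {y : ℕ → V → Finset V → EuclideanSpace ℝ (Fin d)} {v : ℕ → V → EuclideanSpace ℝ (Fin d)}
    (hrun : IsRun G β byz g α x msg y v) :
    ∃ xstar ∈ argminSum f Finset.univ, ∀ i ∉ byz,
      Tendsto (fun t => x t i) atTop (𝓝 xstar) := by
  classical
  obtain ⟨D, -, hD⟩ := hD
  obtain ⟨η, w, hw, hv⟩ := hrun.exists_isMixing hbyz hd hG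
  -- The bound `n - κ < n` contained in `Redundant` excludes `κ = 0`.
  have hκ0 : 0 < kappa G β (d * β) := by
    have := hred.1
    omega
  obtain ⟨S₀, -, hS₀⟩ := Finset.exists_subset_card_eq
    (s := (Finset.univ : Finset V)) (n := kappa G β (d * β)) (by rw [Finset.card_univ]; omega)
  have hfS₀ : ∀ S : Finset V, S.card = kappa G β (d * β) → argminSum f S = argminSum f S₀ :=
    fun S hS => hred.2 S S₀ (by omega) (by omega)
  have hM := argminSum_univ_eq hκ0 hκ.le (hmin S₀ hS₀) hfS₀
  rw [← hM] at hfS₀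
  have hH : (byzᶜ).Nonempty := by
    rw [← Finset.card_pos, Finset.card_compl, hbyz]
    have := hG.1
    omega
  obtain ⟨p, hp, hlim⟩ := hw.exists_tendsto hκ0 hκ.le hH hα_pos hα_anti hα_sum hα_sq hg hD hv
    (fun t i hi => hrun.step t i (by simpa using hi)) (hint.mono interior_subset) hfS₀
    (fun z hz i y => le_of_mem_of_forall_argminSum_eq hf hκ0 hκ hint hfS₀ hz i y)
  exact ⟨p, hp, fun i hi => hlim i (by simpa using hi)⟩

theorem theorem1 {V : Type*} [Fintype V] {d : ℕ}
    -- network, Byzantine agents, objectives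
    (G : Digraph V) (β : ℕ) (byz : Finset V) (hbyz : byz.card ≤ β)
    (f : V → EuclideanSpace ℝ (Fin d) → ℝ) (hf : ∀ i, ConvexOn ℝ Set.univ (f i))
    -- the optimal set of the total objective has nonempty interior
    (hint : (interior (argminSum f Finset.univ)).Nonempty)
    -- uniformly bounded subgradients
    (g : V → EuclideanSpace ℝ (Fin d) → EuclideanSpace ℝ (Fin d))
    (hg : ∀ i x, IsSubgradient (f i) x (g i x))
    (hD : ∃ D : ℝ, 0 < D ∧ ∀ i x, ‖g i x‖ ≤ D)
    -- stepsizes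
    (α : ℕ → ℝ) (hα_pos : ∀ t, 0 < α t) (hα_anti : Antitone α)
    (hα_sum : Tendsto (fun T : ℕ => ∑ t ∈ Finset.range T, α t) atTop atTop)
    (hα_sq : Summable fun t => α t ^ 2)
    -- graph redundancy and objective redundancy
    (hG : Resilient G β (d * β))
    (hred : Redundant f (Fintype.card V - kappa G β (d * β)))
    (hκ : kappa G β (d * β) < Fintype.card V)
    (hmin : ∀ S : Finset V, S.card = kappa G β (d * β) → (argminSum f S).Nonempty)
    -- an arbitrary run
    (x : ℕ → V → EuclideanSpace ℝ (Fin d)) (msg : ℕ → V → V → EuclideanSpace ℝ (Fin d))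
    (y : ℕ → V → Finset V → EuclideanSpace ℝ (Fin d)) (v : ℕ → V → EuclideanSpace ℝ (Fin d))
    (hrun : IsRun G β byz g α x msg y v) :
    ∃ xstar ∈ argminSum f Finset.univ, ∀ i ∉ byz,
      Tendsto (fun t => x t i) atTop (𝓝 xstar) := by
  classical
  have hXne := hint.mono interior_subset
  rcases Nat.eq_zero_or_pos d with rfl | hd
  · obtain ⟨z, hz⟩ := hXne
    refine ⟨z, hz, fun i _ => ?_⟩
    have : (fun t => x t i) = fun _ => z := funext fun t => Subsingleton.elim _ _
    rw [this]
    exact tendsto_const_nhds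
  -- Some agents may be regarded as Byzantine in addition, as long as `i` and `j` are spared.
  have hpair : ∀ i ∉ byz, ∀ j ∉ byz, ∃ p ∈ argminSum f Finset.univ,
      Tendsto (fun t => x t i) atTop (𝓝 p) ∧ Tendsto (fun t => x t j) atTop (𝓝 p) := by
    intro i hi j hj
    -- Room for `β` agents besides `i` and `j`: resilience gives `n ≥ β + dβ + 1`, which is at least
    -- `β + 2` unless `β = 0`.
    have hcard : β ≤ (({i, j} : Finset V)ᶜ).card := by
      have hle : ({i, j} : Finset V).card ≤ 2 := Finset.card_le_two
      have hβ := hG.1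
      have hdβ : β ≤ d * β := Nat.le_mul_of_pos_left β hd
      rw [Finset.card_compl]
      omega
    obtain ⟨byz', hsub, hsub', hcard'⟩ := Finset.exists_subsuperset_card_eq
      (s := byz) (t := ({i, j} : Finset V)ᶜ) (fun k hk => by
        simp only [Finset.mem_compl, Finset.mem_insert, Finset.mem_singleton, not_or]
        exact ⟨fun h => hi (h ▸ hk), fun h => hj (h ▸ hk)⟩) hbyz hcard
    obtain ⟨p, hp, hlim⟩ := (hrun.mono hsub).exists_tendsto_of_card_eq hcard' hd hf hint hg hD
      hα_pos hα_anti hα_sum hα_sq hG hred hκ hmin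
    exact ⟨p, hp, hlim i fun h => by simpa using hsub' h, hlim j fun h => by simpa using hsub' h⟩
  by_cases hne : ∃ i, i ∉ byz
  · obtain ⟨i, hi⟩ := hne
    obtain ⟨p, hp, hpi, -⟩ := hpair i hi i hi
    refine ⟨p, hp, fun j hj => ?_⟩
    obtain ⟨q, -, hqi, hqj⟩ := hpair i hi j hj
    rwa [tendsto_nhds_unique hpi hqi]
  · obtain ⟨z, hz⟩ := hXne
    exact ⟨z, hz, fun i hi => absurd ⟨i, hi⟩ hne⟩
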